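/- Let $\Lambda=\begin{pmatrix}0&-1\\1&0\end{pmatrix}$ and $B=\begin{pmatrix}0&-2\\2&0\end{pmatrix}$, so that $-\Lambda B=2I_2$, and write $\Lambda(\alpha,\beta)=\alpha^{t}\Lambda\beta$ for $\alpha,\beta\in\mathbb Z^2$. Let $\hat{\mathcal T}_\Lambda$ be the complete quantum torus: the $\mathbb Z[\nu^{\pm1}]$-algebra of formal series $\sum_{\alpha\in\mathbb Z^2}c_\alpha X^\alpha$, $c_\alpha\in\mathbb Z[\nu^{\pm1}]$, whose support $\{\alpha: c_\alpha\ne0\}$ is bounded above in both coordinates, with the multiplication determined by $X^\alpha X^\beta=\nu^{\Lambda(\alpha,\beta)}X^{\alpha+\beta}$. The bar involution of $\hat{\mathcal T}_\Lambda$ sends $\sum c_\alpha(\nu) X^\alpha$ to $\sum c_\alpha(\nu^{-1})X^\alpha$. For $l\in\mathbb Z$ let $$X_{\mathcal O(l)}=X^{-\binom{l+1}{-1}}+\sum_{r\ge -l}\nu^{-2(l+r)}\,[l+r+1]_{\nu^4}\,X^{-\binom{l+2r+1}{1}},\qquad [n]_{\nu^4}=\frac{\nu^{4n}-1}{\nu^4-1},$$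 be the quantum cluster character of the line bundle $\mathcal O(l)$ on $\mathbb P^1$. The quantum cluster algebra $\mathcal A(\Lambda,B)$ of $\mathbb P^1$ is the $\mathbb Z[\nu^{\pm1}]$-subalgebra of $\hat{\mathcal T}_\Lambda$ generated by all $X_{\mathcal O(l)}$, $l\in\mathbb Z$. Put $X_{0\delta}=1$ and, for $r\ge 1$, $$X_{r\delta}=X^{-\binom{r}{0}}+X^{-\binom{-r}{0}},\qquad X_\delta=X_{1\delta},$$ and, for $r\ge0$, let $X_{E_x^{(r)}}=\sum_{l=0}^{r}X^{-\binom{r-2l}{0}}$ be the quantum cluster character of the indecomposable torsion sheaf $E_x^{(r)}$ of length $r$ supported at a point $x$ of degree one. Let $$\mathbf B_1^{tor}=\{X_{r\delta}\mid r\ge0\},\qquad \mathbf B_2^{tor}=\{X_\delta^{r}\mid r\ge0\},\qquad \mathbf B_3^{tor}=\{X_{E_x^{(r)}}\mid r\ge0\},$$ $$\bar{\mathbf B}^{vet}=\{\nu^{d(r-d)}X_{\mathcal O(l)}^{d}X_{\mathcal O(l+1)}^{r-d}\mid l\in\mathbb Z,\ r\ge1,\ 1\le d\le r\}.$$ **Theorem.**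 The generators satisfy, for all $l\in\mathbb Z$, the relations $$X_{\mathcal O(l+2)}X_{\mathcal O(l)}=\nu^{2}X_{\mathcal O(l+1)}^2+1,\quad X_{\mathcal O(l)}X_{\mathcal O(l+2)}=\nu^{-2}X_{\mathcal O(l+1)}^2+1,\quad X_{\mathcal O(l+1)}X_{\mathcal O(l)}=\nu^2X_{\mathcal O(l)}X_{\mathcal O(l+1)},$$ and each of the three sets $$\mathbf B_1^{tor}\cup\bar{\mathbf B}^{vet},\qquad \mathbf B_2^{tor}\cup\bar{\mathbf B}^{vet},\qquad \mathbf B_3^{tor}\cup\bar{\mathbf B}^{vet}$$ is a $\mathbb Z[\nu^{\pm1}]$-basis of $\mathcal A(\Lambda,B)$ all of whose elements are fixed by the bar involution. -/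

import Mathlib

open scoped LaurentPolynomial

noncomputable section

namespace QuantumP1

/-- The ground ring `ℤ[ν^{±1}]`; the power `ν ^ n` (`n : ℤ`) is `LaurentPolynomial.T n`. -/
abbrev Coef : Type := LaurentPolynomial ℤ

/-- The power `ν ^ n` of the formal variable, `n : ℤ`. -/
abbrev nu (n : ℤ) : Coef := LaurentPolynomial.T n

/-- The skew-symmetric bilinear form `Λ(α, β) = αᵗ Λ β` of the matrix `Λ = [[0, -1], [1, 0]]`. -/
def lam (α β : ℤ × ℤ) : ℤ := -(α.1 * β.2) + α.2 * β.1

/-- The complete quantum torus of `Λ`. An element `f` stands for the formal series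
`∑ α, f.coeff α • X ^ (-α)` over `ℤ × ℤ`. Membership in `HahnSeries (ℤ × ℤ)` says that the set of
the `α` with nonzero coefficient is partially well-ordered for the componentwise order, which for
`ℤ × ℤ` means that it is bounded below in both coordinates. Only the additive structure is that of
`HahnSeries`; the multiplication is twisted by `Λ`, see below. -/
def Torus : Type := HahnSeries (ℤ × ℤ) Coef

namespace Torus

open scoped Pointwise

instance : AddCommGroup Torus := inferInstanceAs (AddCommGroup (HahnSeries (ℤ × ℤ) Coef))

instance : Module Coef Torus := inferInstanceAs (Module Coef (HahnSeries (ℤ × ℤ) Coef))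

/-- The coefficient of `X ^ (-α)`. -/
def coeff (f : Torus) (α : ℤ × ℤ) : Coef := HahnSeries.coeff f α

theorem isPWO (f : Torus) : (Function.support f.coeff).IsPWO := HahnSeries.isPWO_support f

@[ext]
theorem ext {f g : Torus} (h : ∀ α, f.coeff α = g.coeff α) : f = g :=
  HahnSeries.ext (funext h)

@[simp]
theorem coeff_add (f g : Torus) (α : ℤ × ℤ) : (f + g).coeff α = f.coeff α + g.coeff α := rfl

@[simp]
theorem coeff_zero (α : ℤ × ℤ) : (0 : Torus).coeff α = 0 := rfl

@[simp]
theorem coeff_smul (r : Coef) (f : Torus) (α : ℤ × ℤ) : (r • f).coeff α = r * f.coeff α := rfl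

/-- The monomial `X ^ α`. -/
def mono (α : ℤ × ℤ) : Torus := HahnSeries.single (-α) (1 : Coef)

theorem coeff_mono (α β : ℤ × ℤ) : (mono α).coeff β = if β = -α then 1 else 0 := by
  change (HahnSeries.single (-α) (1 : Coef)).coeff β = _
  by_cases h : β = -α
  · rw [if_pos h, h, HahnSeries.coeff_single_same]
  · rw [if_neg h, HahnSeries.coeff_single_of_ne h]

/-- The twisted multiplication: the continuous bilinear extension of
`X ^ α * X ^ β = ν ^ Λ(α, β) X ^ (α + β)` (note that `Λ(-α, -β) = Λ(α, β)`). -/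
instance : Mul Torus where
  mul f g :=
    { coeff := fun γ => ∑ p ∈ Finset.antidiagonal f.isPWO g.isPWO γ,
        nu (lam p.1 p.2) * (f.coeff p.1 * g.coeff p.2)
      isPWO_support' := by
        refine (f.isPWO.add g.isPWO).mono fun γ hγ => ?_
        obtain ⟨p, hp, -⟩ := Finset.exists_ne_zero_of_sum_ne_zero hγ
        obtain ⟨h1, h2, h3⟩ := Finset.mem_antidiagonal.1 hp
        exact ⟨p.1, h1, p.2, h2, h3⟩ }

instance : One Torus where
  one := mono 0

theorem one_def : (1 : Torus) = mono 0 := rfl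

theorem coeff_mul (f g : Torus) (γ : ℤ × ℤ) :
    (f * g).coeff γ = ∑ p ∈ Finset.antidiagonal f.isPWO g.isPWO γ,
      nu (lam p.1 p.2) * (f.coeff p.1 * g.coeff p.2) := rfl

/-- The sum defining a coefficient of a product may be taken over larger sets of indices. -/
theorem coeff_mul_of_subset (f g : Torus) {s t : Set (ℤ × ℤ)} (hs : s.IsPWO) (ht : t.IsPWO)
    (hfs : Function.support f.coeff ⊆ s) (hgt : Function.support g.coeff ⊆ t) (γ : ℤ × ℤ) :
    (f * g).coeff γ = ∑ p ∈ Finset.antidiagonal hs ht γ,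
      nu (lam p.1 p.2) * (f.coeff p.1 * g.coeff p.2) := by
  rw [coeff_mul]
  apply Finset.sum_subset
  · intro p hp
    obtain ⟨h1, h2, h3⟩ := Finset.mem_antidiagonal.1 hp
    exact Finset.mem_antidiagonal.2 ⟨hfs h1, hgt h2, h3⟩
  · intro p hp hn
    obtain ⟨-, -, h3⟩ := Finset.mem_antidiagonal.1 hp
    by_cases h1 : f.coeff p.1 = 0
    · simp [h1]
    by_cases h2 : g.coeff p.2 = 0
    · simp [h2]
    exact absurd (Finset.mem_antidiagonal.2 ⟨h1, h2, h3⟩) hn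

theorem support_mul (f g : Torus) :
    Function.support (f * g).coeff ⊆ Function.support f.coeff + Function.support g.coeff := by
  intro γ hγ
  obtain ⟨p, hp, -⟩ := Finset.exists_ne_zero_of_sum_ne_zero hγ
  obtain ⟨h1, h2, h3⟩ := Finset.mem_antidiagonal.1 hp
  exact ⟨p.1, h1, p.2, h2, h3⟩

theorem mul_add_aux (f g h : Torus) : f * (g + h) = f * g + f * h := by
  ext1 γ
  have hu := g.isPWO.union h.isPWO
  have hgh : Function.support (g + h).coeff ⊆ Function.support g.coeff ∪ Function.support h.coeff :=
    Function.support_add g.coeff h.coeff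
  rw [coeff_add, coeff_mul_of_subset f (g + h) f.isPWO hu subset_rfl hgh,
    coeff_mul_of_subset f g f.isPWO hu subset_rfl Set.subset_union_left,
    coeff_mul_of_subset f h f.isPWO hu subset_rfl Set.subset_union_right,
    ← Finset.sum_add_distrib]
  exact Finset.sum_congr rfl fun p _ => by rw [coeff_add]; ring

theorem add_mul_aux (f g h : Torus) : (f + g) * h = f * h + g * h := by
  ext1 γ
  have hu := f.isPWO.union g.isPWO
  have hfg : Function.support (f + g).coeff ⊆ Function.support f.coeff ∪ Function.support g.coeff :=
    Function.support_add f.coeff g.coeff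
  rw [coeff_add, coeff_mul_of_subset (f + g) h hu h.isPWO hfg subset_rfl,
    coeff_mul_of_subset f h hu h.isPWO Set.subset_union_left subset_rfl,
    coeff_mul_of_subset g h hu h.isPWO Set.subset_union_right subset_rfl,
    ← Finset.sum_add_distrib]
  exact Finset.sum_congr rfl fun p _ => by rw [coeff_add]; ring

theorem smul_mul_aux (r : Coef) (f g : Torus) : r • f * g = r • (f * g) := by
  ext1 γ
  have hf : Function.support (r • f).coeff ⊆ Function.support f.coeff := fun α hα h0 =>
    hα (by rw [coeff_smul, h0, mul_zero])
  rw [coeff_smul, coeff_mul_of_subset (r • f) g f.isPWO g.isPWO hf subset_rfl, coeff_mul,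
    Finset.mul_sum]
  exact Finset.sum_congr rfl fun p _ => by rw [coeff_smul]; ring

theorem mul_smul_aux (r : Coef) (f g : Torus) : f * r • g = r • (f * g) := by
  ext1 γ
  have hg : Function.support (r • g).coeff ⊆ Function.support g.coeff := fun α hα h0 =>
    hα (by rw [coeff_smul, h0, mul_zero])
  rw [coeff_smul, coeff_mul_of_subset f (r • g) f.isPWO g.isPWO subset_rfl hg, coeff_mul,
    Finset.mul_sum]
  exact Finset.sum_congr rfl fun p _ => by rw [coeff_smul]; ring

theorem mono_support (α : ℤ × ℤ) : Function.support (mono α).coeff ⊆ {-α} := by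
  intro β hβ
  by_contra hne
  exact hβ ((coeff_mono α β).trans (if_neg fun h => hne h))

theorem coeff_mono_mul (α : ℤ × ℤ) (g : Torus) (γ : ℤ × ℤ) :
    (mono α * g).coeff γ = nu (lam (-α) (γ + α)) * g.coeff (γ + α) := by
  rw [coeff_mul_of_subset (mono α) g (Set.isPWO_singleton (-α)) g.isPWO (mono_support α) subset_rfl]
  rw [Finset.sum_eq_single (-α, γ + α)]
  · simp [coeff_mono]
  · rintro ⟨a, b⟩ hp hne
    obtain ⟨h1, -, h3⟩ := Finset.mem_antidiagonal.1 hp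
    obtain rfl : a = -α := h1
    have hb : b = γ + α := by rw [← h3]; change b = -α + b + α; abel
    exact absurd (by rw [hb]) hne
  · intro hn
    by_cases h0 : g.coeff (γ + α) = 0
    · simp [h0]
    · refine absurd ?_ hn
      rw [Finset.mem_antidiagonal]
      refine ⟨Set.mem_singleton _, Function.mem_support.2 h0, ?_⟩
      change -α + (γ + α) = γ
      abel

theorem coeff_mul_mono (α : ℤ × ℤ) (f : Torus) (γ : ℤ × ℤ) :
    (f * mono α).coeff γ = nu (lam (γ + α) (-α)) * f.coeff (γ + α) := by
  rw [coeff_mul_of_subset f (mono α) f.isPWO (Set.isPWO_singleton (-α)) subset_rfl (mono_support α)]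
  rw [Finset.sum_eq_single (γ + α, -α)]
  · simp [coeff_mono]
  · rintro ⟨a, b⟩ hp hne
    obtain ⟨-, h2, h3⟩ := Finset.mem_antidiagonal.1 hp
    obtain rfl : b = -α := h2
    have ha : a = γ + α := by rw [← h3]; change a = a + -α + α; abel
    exact absurd (by rw [ha]) hne
  · intro hn
    by_cases h0 : f.coeff (γ + α) = 0
    · simp [h0]
    · refine absurd ?_ hn
      rw [Finset.mem_antidiagonal]
      refine ⟨Function.mem_support.2 h0, Set.mem_singleton _, ?_⟩
      change γ + α + -α = γ
      abel

theorem mono_mul_mono (α β : ℤ × ℤ) : mono α * mono β = nu (lam α β) • mono (α + β) := by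
  ext1 γ
  rw [coeff_mono_mul, coeff_smul, coeff_mono, coeff_mono]
  by_cases h : γ + α = -β
  · have h' : γ = -(α + β) := by rw [eq_sub_of_add_eq h, neg_add_rev, sub_eq_add_neg]
    rw [if_pos h, if_pos h', h]
    simp [lam]
  · have h' : γ ≠ -(α + β) := fun h' => h (by rw [h']; abel)
    rw [if_neg h, if_neg h', mul_zero, mul_zero]

theorem mul_assoc_aux (f g h : Torus) : f * g * h = f * (g * h) := by
  ext1 γ
  rw [coeff_mul_of_subset (f * g) h (f.isPWO.add g.isPWO) h.isPWO (support_mul f g) subset_rfl,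
    coeff_mul_of_subset f (g * h) f.isPWO (g.isPWO.add h.isPWO) subset_rfl (support_mul g h)]
  simp only [coeff_mul, Finset.sum_mul, Finset.mul_sum, Finset.sum_sigma']
  refine Finset.sum_nbij' (fun q => ⟨(q.2.1, q.2.2 + q.1.2), (q.2.2, q.1.2)⟩)
    (fun q => ⟨(q.1.1 + q.2.1, q.2.2), (q.1.1, q.2.1)⟩) ?_ ?_ ?_ ?_ ?_
  · rintro ⟨⟨a, b⟩, ⟨c, d⟩⟩ hq
    simp only [Finset.mem_sigma, Finset.mem_antidiagonal] at hq ⊢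
    obtain ⟨⟨h1, h2, h3⟩, h4, h5, h6⟩ := hq
    exact ⟨⟨h4, Set.add_mem_add h5 h2, by rw [← add_assoc, h6, h3]⟩, h5, h2, trivial⟩
  · rintro ⟨⟨a, b⟩, ⟨c, d⟩⟩ hq
    simp only [Finset.mem_sigma, Finset.mem_antidiagonal] at hq ⊢
    obtain ⟨⟨h1, h2, h3⟩, h4, h5, h6⟩ := hq
    exact ⟨⟨Set.add_mem_add h1 h4, h5, by rw [add_assoc, h6, h3]⟩, h1, h4, trivial⟩
  · rintro ⟨⟨a, b⟩, ⟨c, d⟩⟩ hq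
    simp only [Finset.mem_sigma, Finset.mem_antidiagonal] at hq
    obtain ⟨-, -, -, h6⟩ := hq
    simp [h6]
  · rintro ⟨⟨a, b⟩, ⟨c, d⟩⟩ hq
    simp only [Finset.mem_sigma, Finset.mem_antidiagonal] at hq
    obtain ⟨-, -, -, h6⟩ := hq
    simp [h6]
  · rintro ⟨⟨a, b⟩, ⟨c, d⟩⟩ hq
    simp only [Finset.mem_sigma, Finset.mem_antidiagonal] at hq
    obtain ⟨-, -, -, h6⟩ := hq
    have e : nu (lam a b) * nu (lam c d) = nu (lam c (d + b)) * nu (lam d b) := by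
      rw [nu, nu, nu, nu, ← LaurentPolynomial.T_add, ← LaurentPolynomial.T_add, ← h6]
      congr 1
      simp only [lam, Prod.fst_add, Prod.snd_add]
      ring
    linear_combination (f.coeff c * g.coeff d * h.coeff b) * e

instance : Ring Torus where
  __ := (inferInstance : AddCommGroup Torus)
  left_distrib := mul_add_aux
  right_distrib := add_mul_aux
  zero_mul f := by simpa using smul_mul_aux 0 0 f
  mul_zero f := by simpa using mul_smul_aux 0 f 0
  mul_assoc := mul_assoc_aux
  one_mul f := by ext1 γ; rw [one_def, coeff_mono_mul]; simp [lam]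
  mul_one f := by ext1 γ; rw [one_def, coeff_mul_mono]; simp [lam]

instance : Algebra Coef Torus := Algebra.ofModule smul_mul_aux mul_smul_aux

/-- The bar involution `ν ↦ ν⁻¹`, `X ^ α ↦ X ^ α`. -/
def bar (f : Torus) : Torus := HahnSeries.map f (LaurentPolynomial.invert (R := ℤ))

end Torus

open Torus

/-- The quantum integer `[n]_{ν⁴} = (ν ^ (4 n) - 1) / (ν ^ 4 - 1) = ∑_{j < n} ν ^ (4 j)`. -/
def qInt (n : ℕ) : Coef := ∑ j ∈ Finset.range n, nu (4 * j)

/-- The strictly increasing map `n ↦ (l + 2 r + 1, 1)`, where `r = n - l`. -/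
def lineExp (l : ℤ) : ℕ ↪o ℤ × ℤ :=
  OrderEmbedding.ofMapLEIff (fun n => (l + 2 * ((n : ℤ) - l) + 1, 1)) fun a b => by
    simp only [Prod.mk_le_mk, le_refl, and_true]
    omega

/-- The series `∑_{r ≥ -l} ν ^ (-2 (l + r)) [l + r + 1]_{ν⁴} X ^ (-(l + 2 r + 1, 1))`, summed over
`n = l + r ∈ ℕ`. -/
def lineTail (l : ℤ) : Torus :=
  HahnSeries.embDomain (lineExp l)
    { coeff := fun n => nu (-2 * n) * qInt (n + 1)
      isPWO_support' := Set.isPWO_of_wellQuasiOrderedLE _ }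

/-- The quantum cluster character `X_{O(l)}` of the line bundle `O(l)` on the projective line. -/
def XO (l : ℤ) : Torus := mono (-(l + 1, -1)) + lineTail l

/-- The quantum cluster algebra `A(Λ, B)` of the projective line: the `ℤ[ν^{±1}]`-subalgebra of the
complete quantum torus that is generated by the characters of all line bundles. -/
def clusterAlgebra : Subalgebra Coef Torus := Algebra.adjoin Coef (Set.range XO)

/-- The element `X_{rδ}`: it is `X ^ (-(r, 0)) + X ^ (-(-r, 0))` for `r ≥ 1`, and `X_{0δ} = 1`. -/
def Xdelta (r : ℕ) : Torus :=
  if r = 0 then 1 else mono (-((r : ℤ), 0)) + mono (-(-(r : ℤ), 0))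

/-- The quantum cluster character of the indecomposable torsion sheaf of length `r` supported at a
point of degree one: `∑_{l = 0}^{r} X ^ (-(r - 2 l, 0))`. -/
def XE (r : ℕ) : Torus := ∑ l ∈ Finset.range (r + 1), mono (-((r : ℤ) - 2 * (l : ℤ), 0))

/-- `{X_{rδ} | r ∈ ℕ}` -/
def torBasis₁ : Set Torus := Set.range Xdelta

/-- `{X_δ ^ r | r ∈ ℕ}` -/
def torBasis₂ : Set Torus := Set.range fun r : ℕ => Xdelta 1 ^ r

/-- `{X_{E_x^{(r)}} | r ∈ ℕ}` -/
def torBasis₃ : Set Torus := Set.range XE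

/-- `{ν ^ (d (r - d)) X_{O(l)} ^ d X_{O(l + 1)} ^ (r - d) | l ∈ ℤ, r ≥ 1, 1 ≤ d ≤ r}` -/
def vetBasis : Set Torus :=
  {f | ∃ (l : ℤ) (r d : ℕ), 1 ≤ d ∧ d ≤ r ∧
    f = nu ((d : ℤ) * ((r - d : ℕ) : ℤ)) • (XO l ^ d * XO (l + 1) ^ (r - d))}

/-- `S` is a bar-invariant `ℤ[ν^{±1}]`-basis of the quantum cluster algebra. -/
structure IsBarInvariantBasis (S : Set Torus) : Prop where
  linearIndepOn : LinearIndepOn Coef id S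
  span_eq : Submodule.span Coef S = Subalgebra.toSubmodule clusterAlgebra
  bar_eq : ∀ f ∈ S, bar f = f

end QuantumP1

end

noncomputable section

namespace QuantumP1

namespace Torus

/-! The character `XO l` is a monomial in row `-1` (second coordinate) plus a tail in row `1`. A
product of two characters therefore lives in rows `-2`, `0` and `2`. The outer rows obey the
relations because horizontal monomials can be moved between the factors. Row `0` reduces to two
recurrences for `tailCoeff`, interchanged by `ν ↦ ν⁻¹`.

Independence comes from leading terms: ordering exponents lexicographically, second coordinate
first, each proposed basis element has a least exponent with unit coefficient. These exponents are
`(-n, 0)` on the torsion part and `(r (l + 1) + (r - d), -r)` on the rest. They are distinct because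
`0 ≤ r - d < r` is a remainder modulo `r` (`vet_index_unique`).

Spanning (`normalSpan_eq`): the span of the powers of `X_δ` and the ordered monomials contains `1`
and is stable under right multiplication by every generator. Since `X_δ` shifts line bundles by `±1`
(`XO_mul_Xdelta_one`), stability under `X_δ` reduces all generators to two consecutive ones. The
other torsion families are monic polynomials in `X_δ`, given by Chebyshev recurrences, so they
change neither the span nor the leading exponents. -/

@[simp]
theorem coeff_bar (f : Torus) (α : ℤ × ℤ) :
    (bar f).coeff α = LaurentPolynomial.invert (f.coeff α) := rfl

theorem coeff_sum {ι : Type*} (s : Finset ι) (f : ι → Torus) (α : ℤ × ℤ) :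
    (∑ i ∈ s, f i).coeff α = ∑ i ∈ s, (f i).coeff α :=
  map_sum (AddMonoidHom.mk' (fun f : Torus => f.coeff α) fun _ _ => rfl) f s

theorem nu_smul_nu_smul (m n : ℤ) (f : Torus) : nu m • nu n • f = nu (m + n) • f := by
  rw [smul_smul, ← LaurentPolynomial.T_add]

theorem nu_zero_smul (f : Torus) : nu 0 • f = f := by
  rw [nu, LaurentPolynomial.T_zero, one_smul]

/-! ### The bar involution -/

theorem bar_add (f g : Torus) : bar (f + g) = bar f + bar g := by
  ext1 α; simp

theorem bar_smul (r : Coef) (f : Torus) :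
    bar (r • f) = LaurentPolynomial.invert r • bar f := by
  ext1 α; simp

theorem bar_nu_smul (n : ℤ) (f : Torus) : bar (nu n • f) = nu (-n) • bar f := by
  rw [bar_smul, LaurentPolynomial.invert_T]

theorem bar_sum {ι : Type*} (s : Finset ι) (f : ι → Torus) :
    bar (∑ i ∈ s, f i) = ∑ i ∈ s, bar (f i) :=
  map_sum (AddMonoidHom.mk' bar bar_add) f s

theorem bar_mono (α : ℤ × ℤ) : bar (mono α) = mono α := by
  ext1 β
  rw [coeff_bar, coeff_mono]
  split_ifs <;> simp

theorem bar_one : bar 1 = 1 := bar_mono 0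

theorem lam_swap (α β : ℤ × ℤ) : lam β α = -lam α β := by
  simp only [lam]; ring

/-- Inverting `ν` negates the twist, and skew-symmetry of `Λ` absorbs that sign by swapping the
factors. -/
theorem bar_mul (f g : Torus) : bar (f * g) = bar g * bar f := by
  have hsupp (h : Torus) : Function.support (bar h).coeff ⊆ Function.support h.coeff :=
    fun α hα h0 => hα (by rw [coeff_bar, h0, map_zero])
  ext1 γ
  rw [coeff_mul_of_subset (bar g) (bar f) g.isPWO f.isPWO (hsupp g) (hsupp f), coeff_bar,
    coeff_mul, map_sum]
  refine Finset.sum_nbij' Prod.swap Prod.swap ?_ ?_ (fun _ _ => rfl) (fun _ _ => rfl) ?_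
  · rintro ⟨a, b⟩ hp
    obtain ⟨h1, h2, h3⟩ := Finset.mem_antidiagonal.1 hp
    exact Finset.mem_antidiagonal.2 ⟨h2, h1, (add_comm b a).trans h3⟩
  · rintro ⟨a, b⟩ hp
    obtain ⟨h1, h2, h3⟩ := Finset.mem_antidiagonal.1 hp
    exact Finset.mem_antidiagonal.2 ⟨h2, h1, (add_comm b a).trans h3⟩
  · rintro ⟨a, b⟩ -
    simp only [Prod.swap, coeff_bar, map_mul, LaurentPolynomial.invert_T, lam_swap a b]
    ring

theorem bar_pow {f : Torus} (hf : bar f = f) (n : ℕ) : bar (f ^ n) = f ^ n := by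
  induction n with
  | zero => rw [pow_zero, bar_one]
  | succ n ih => rw [pow_succ, bar_mul, ih, hf, ← pow_succ', pow_succ]

/-! ### Leading terms -/

/-- Exponents are compared lexicographically, the second coordinate first. -/
def rank (α : ℤ × ℤ) : ℤ ×ₗ ℤ := toLex (α.2, α.1)

theorem rank_add (α β : ℤ × ℤ) : rank (α + β) = rank α + rank β := rfl

theorem rank_injective : Function.Injective rank := fun α β h => by
  have h' : (α.2, α.1) = (β.2, β.1) := toLex.injective h
  rw [Prod.mk.injEq] at h'
  exact Prod.ext h'.2 h'.1

theorem rank_lt_iff {α β : ℤ × ℤ} :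
    rank α < rank β ↔ α.2 < β.2 ∨ α.2 = β.2 ∧ α.1 < β.1 := Prod.Lex.toLex_lt_toLex

/-- The exponent `k` is the least one in the support of `f`, and its coefficient is a unit. -/
structure HasLeadingUnit (f : Torus) (k : ℤ × ℤ) : Prop where
  isUnit : IsUnit (f.coeff k)
  le : ∀ α, f.coeff α ≠ 0 → rank k ≤ rank α

namespace HasLeadingUnit

theorem eq {f : Torus} {k k' : ℤ × ℤ} (h : HasLeadingUnit f k) (h' : HasLeadingUnit f k') :
    k = k' :=
  rank_injective (le_antisymm (h.le _ h'.isUnit.ne_zero) (h'.le _ h.isUnit.ne_zero))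

theorem mul {f g : Torus} {k k' : ℤ × ℤ} (hf : HasLeadingUnit f k) (hg : HasLeadingUnit g k') :
    HasLeadingUnit (f * g) (k + k') where
  isUnit := by
    rw [coeff_mul, Finset.sum_eq_single (k, k')]
    · exact (LaurentPolynomial.isUnit_T _).mul (hf.isUnit.mul hg.isUnit)
    · rintro ⟨a, b⟩ hp hne
      obtain ⟨h1, h2, h3⟩ := Finset.mem_antidiagonal.1 hp
      have h4 : rank k + rank k' = rank a + rank b := by
        rw [← rank_add, ← rank_add]; exact congrArg rank h3.symm
      -- In a totally ordered group, a sum of two minima is attained by that pair only.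
      have h5 := (add_eq_add_iff_eq_and_eq (hf.le a h1) (hg.le b h2)).1 h4
      rw [rank_injective h5.1, rank_injective h5.2] at hne
      exact absurd rfl hne
    · intro hn
      refine absurd ?_ hn
      rw [Finset.mem_antidiagonal]
      exact ⟨hf.isUnit.ne_zero, hg.isUnit.ne_zero, rfl⟩
  le := by
    intro γ hγ
    obtain ⟨a, ha, b, hb, rfl⟩ := support_mul f g hγ
    simpa only [rank_add] using add_le_add (hf.le a ha) (hg.le b hb)

theorem mono_neg (k : ℤ × ℤ) : HasLeadingUnit (mono (-k)) k where
  isUnit := by simp [coeff_mono]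
  le := by
    intro α hα
    rw [coeff_mono, neg_neg] at hα
    have : α = k := by by_contra h; exact hα (if_neg h)
    rw [this]

theorem one : HasLeadingUnit 1 0 := by
  simpa [one_def] using mono_neg 0

theorem pow {f : Torus} {k : ℤ × ℤ} (hf : HasLeadingUnit f k) (n : ℕ) :
    HasLeadingUnit (f ^ n) (n • k) := by
  induction n with
  | zero => simpa using one
  | succ n ih => rw [pow_succ, succ_nsmul]; exact ih.mul hf

theorem nu_smul {f : Torus} {k : ℤ × ℤ} (hf : HasLeadingUnit f k) (n : ℤ) :
    HasLeadingUnit (nu n • f) k where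
  isUnit := (LaurentPolynomial.isUnit_T n).mul hf.isUnit
  le α hα := hf.le α (right_ne_zero_of_mul hα)

theorem add {f g : Torus} {k : ℤ × ℤ} (hf : HasLeadingUnit f k)
    (hg : ∀ α, g.coeff α ≠ 0 → rank k < rank α) : HasLeadingUnit (f + g) k where
  isUnit := by
    have : g.coeff k = 0 := by
      by_contra h
      exact lt_irrefl _ (hg k h)
    rw [coeff_add, this, add_zero]
    exact hf.isUnit
  le α hα := by
    by_cases h : f.coeff α = 0
    · rw [coeff_add, h, zero_add] at hα
      exact (hg α hα).le
    · exact hf.le α h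

end HasLeadingUnit

/-- In a vanishing combination, choose a term of nonzero scalar with least leading exponent. No
other term reaches that exponent, so the scalar times a unit is zero. -/
theorem linearIndepOn_of_hasLeadingUnit {S : Set Torus}
    (hS : ∀ f ∈ S, ∃ k, HasLeadingUnit f k)
    (hinj : ∀ f ∈ S, ∀ g ∈ S, ∀ k, HasLeadingUnit f k → HasLeadingUnit g k → f = g) :
    LinearIndepOn Coef id S := by
  choose! k hk using hS
  rw [LinearIndepOn, linearIndependent_iff']
  intro s c hc
  by_contra! hne
  obtain ⟨i₀, hi₀, hci₀⟩ := hne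
  obtain ⟨i, hi, hmin⟩ := Finset.exists_min_image (s.filter fun i => c i ≠ 0)
    (fun i => rank (k i)) ⟨i₀, Finset.mem_filter.2 ⟨hi₀, hci₀⟩⟩
  rw [Finset.mem_filter] at hi
  have h := congrArg (fun f : Torus => f.coeff (k i)) hc
  simp only [coeff_sum, coeff_smul, coeff_zero, id] at h
  rw [Finset.sum_eq_single i] at h
  · exact hi.2 ((hk i i.2).isUnit.mul_left_eq_zero.1 h)
  · intro j hj hji
    by_contra hne
    have h1 := left_ne_zero_of_mul hne
    have h2 := (hk j j.2).le _ (right_ne_zero_of_mul hne)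
    have h3 := hmin j (Finset.mem_filter.2 ⟨hj, h1⟩)
    have h4 : k j = k i := rank_injective (le_antisymm h2 h3)
    exact hji (Subtype.ext (hinj j j.2 i i.2 (k i) (h4 ▸ hk j j.2) (hk i i.2)))
  · intro hn
    exact absurd hi.1 hn

end Torus

open Torus

/-! ### The characters of line bundles -/

/-- The coefficient of `X ^ (-(m + 1 - l, 1))` in `X_{O(l)}`. -/
def tailCoeff (m : ℤ) : Coef :=
  if 0 ≤ m ∧ Even m then nu (-m) * qInt ((m / 2).toNat + 1) else 0

/-- The indicator function of the even natural numbers. -/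
def evenInd (m : ℤ) : Coef := if 0 ≤ m ∧ Even m then 1 else 0

theorem tailCoeff_of_not {m : ℤ} (h : ¬(0 ≤ m ∧ Even m)) : tailCoeff m = 0 := if_neg h

theorem tailCoeff_two_mul (n : ℕ) : tailCoeff (2 * n) = nu (-2 * n) * qInt (n + 1) := by
  rw [tailCoeff, if_pos ⟨by positivity, even_two_mul _⟩]
  simp

/-- This difference is the source of the constant term `1` in the exchange relation. -/
theorem evenInd_sub (m : ℤ) : evenInd m - evenInd (m - 2) = if m = 0 then 1 else 0 := by
  simp only [evenInd]
  by_cases he : Even m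
  · have : Even (m - 2) := he.sub even_two
    simp only [he, this, and_true]
    obtain ⟨k, hk⟩ := he
    split_ifs <;> first | omega | simp
  · have h0 : m ≠ 0 := fun h => he (h ▸ Even.zero)
    have : ¬Even (m - 2) := fun h => he (by simpa using h.add even_two)
    simp [he, this, h0]

theorem qInt_succ_succ (n : ℕ) : qInt (n + 2) = qInt (n + 1) + nu (4 * (n + 1)) := by
  rw [qInt, Finset.sum_range_succ, ← qInt]
  push_cast
  rfl

theorem qInt_succ_succ' (n : ℕ) : qInt (n + 2) = nu 4 * qInt (n + 1) + 1 := by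
  rw [qInt, Finset.sum_range_succ', qInt, Finset.mul_sum]
  congr 1
  · refine Finset.sum_congr rfl fun j _ => ?_
    rw [← LaurentPolynomial.T_add]
    congr 1
    push_cast
    ring

theorem qInt_one : qInt 1 = 1 := by simp [qInt]

/-- The reduction of a statement on all integers to the even natural numbers. -/
theorem tailCoeff_cases {P : ℤ → Prop} (h : ∀ m, ¬(0 ≤ m ∧ Even m) → P m) (h0 : P 0)
    (hs : ∀ n : ℕ, P (2 * (n + 1 : ℕ))) (m : ℤ) : P m := by
  by_cases hm : 0 ≤ m ∧ Even m
  · obtain ⟨hm, k, rfl⟩ := hm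
    obtain ⟨n, rfl⟩ := Int.eq_ofNat_of_zero_le (show 0 ≤ k by omega)
    cases n with
    | zero => exact h0
    | succ n => rw [← two_mul]; exact hs n
  · exact h m hm

theorem not_even_sub_two {m : ℤ} (hm : ¬(0 ≤ m ∧ Even m)) : ¬(0 ≤ m - 2 ∧ Even (m - 2)) :=
  fun h => hm ⟨by omega, by simpa using h.2.add even_two⟩

theorem tailCoeff_zero : tailCoeff 0 = 1 := by
  simpa [qInt_one] using tailCoeff_two_mul 0

theorem tailCoeff_rec (m : ℤ) :
    tailCoeff m = nu 2 * tailCoeff (m - 2) + evenInd m * nu (-m) := by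
  induction m using tailCoeff_cases with
  | h m hm =>
    rw [tailCoeff_of_not hm, tailCoeff_of_not (not_even_sub_two hm), evenInd, if_neg hm]; ring
  | h0 => rw [tailCoeff_zero, tailCoeff_of_not (by omega)]; simp [evenInd]
  | hs n =>
    have e : (2 * (n + 1 : ℕ) : ℤ) - 2 = 2 * n := by push_cast; ring
    rw [e, tailCoeff_two_mul, tailCoeff_two_mul, evenInd,
      if_pos ⟨by positivity, even_two_mul _⟩, qInt_succ_succ']
    have e1 : nu (-2 * (n + 1 : ℕ)) * nu 4 = nu 2 * nu (-2 * n) := by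
      rw [← LaurentPolynomial.T_add, ← LaurentPolynomial.T_add]; congr 1; push_cast; ring
    rw [mul_add, ← mul_assoc, e1, ← neg_mul (2 : ℤ) (n + 1 : ℕ)]
    ring

theorem tailCoeff_rec' (m : ℤ) :
    tailCoeff m = nu (-2) * tailCoeff (m - 2) + evenInd m * nu m := by
  induction m using tailCoeff_cases with
  | h m hm =>
    rw [tailCoeff_of_not hm, tailCoeff_of_not (not_even_sub_two hm), evenInd, if_neg hm]; ring
  | h0 => rw [tailCoeff_zero, tailCoeff_of_not (by omega)]; simp [evenInd]
  | hs n =>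
    have e : (2 * (n + 1 : ℕ) : ℤ) - 2 = 2 * n := by push_cast; ring
    rw [e, tailCoeff_two_mul, tailCoeff_two_mul, evenInd,
      if_pos ⟨by positivity, even_two_mul _⟩, qInt_succ_succ]
    have e1 : nu (-2 * (n + 1 : ℕ)) = nu (-2) * nu (-2 * n) := by
      rw [← LaurentPolynomial.T_add]; congr 1; push_cast; ring
    have e2 : nu (-2 * (n + 1 : ℕ)) * nu (4 * (n + 1)) = nu (2 * (n + 1 : ℕ)) := by
      rw [← LaurentPolynomial.T_add]; congr 1; push_cast; ring
    rw [mul_add, e2, e1]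
    ring

theorem invert_tailCoeff (m : ℤ) : LaurentPolynomial.invert (tailCoeff m) = tailCoeff m := by
  by_cases hm : 0 ≤ m ∧ Even m
  · obtain ⟨hm, k, rfl⟩ := hm
    obtain ⟨n, rfl⟩ := Int.eq_ofNat_of_zero_le (show 0 ≤ k by omega)
    clear hm
    rw [← two_mul]
    induction n with
    | zero => simp [tailCoeff_zero]
    | succ n ih =>
      have e : (2 * (n + 1 : ℕ) : ℤ) - 2 = 2 * n := by push_cast; ring
      have h1 := tailCoeff_rec (2 * (n + 1 : ℕ))
      have h2 := tailCoeff_rec' (2 * (n + 1 : ℕ))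
      rw [evenInd, if_pos ⟨by positivity, even_two_mul _⟩, e, one_mul] at h1 h2
      -- Expanding one side by each recurrence makes inversion of `ν` match them term by term.
      conv_lhs => rw [h1]
      rw [h2]
      simp only [map_add, map_mul, ih, LaurentPolynomial.invert_T, neg_neg]
  · rw [tailCoeff_of_not hm, map_zero]

/-! ### Products of tails and monomials -/

theorem coeff_lineTail (l a b : ℤ) :
    (lineTail l).coeff (a, b) = if b = 1 then tailCoeff (a + l - 1) else 0 := by
  by_cases h : (a, b) ∈ Set.range (lineExp l)
  · obtain ⟨n, hn⟩ := h
    have hn' : (l + 2 * ((n : ℤ) - l) + 1, (1 : ℤ)) = (a, b) := hn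
    rw [Prod.mk.injEq] at hn'
    have e : a + l - 1 = 2 * n := by linarith [hn'.1]
    rw [if_pos hn'.2.symm, e, tailCoeff_two_mul, ← hn]
    exact HahnSeries.embDomain_coeff
  · have h0 : (lineTail l).coeff (a, b) = 0 := HahnSeries.embDomain_of_notMem_range h
    rw [h0]
    split_ifs with hb
    · refine (tailCoeff_of_not fun hm => h ?_).symm
      obtain ⟨hm, k, hk⟩ := hm
      refine ⟨k.toNat, ?_⟩
      change (l + 2 * ((k.toNat : ℤ) - l) + 1, (1 : ℤ)) = (a, b)
      rw [Prod.mk.injEq]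
      omega
    · rfl

/-- The coefficients in row `1` depend only on `a + l - 1`, so a horizontal translation is a change
of `l`; the twist is constant along the row. -/
theorem mono_mul_lineTail (k l : ℤ) :
    mono (-(k, 0)) * lineTail l = nu (-k) • lineTail (l - k) := by
  ext1 ⟨a, b⟩
  simp only [coeff_mono_mul, coeff_smul, coeff_lineTail, lam, Prod.neg_mk, Prod.mk_add_mk]
  have e : a + -k + l - 1 = a + (l - k) - 1 := by ring
  by_cases hb : b = 1
  · subst hb; simp [e]
  · simp [hb]

theorem lineTail_mul_mono (k l : ℤ) :
    lineTail l * mono (-(k, 0)) = nu k • lineTail (l - k) := by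
  ext1 ⟨a, b⟩
  simp only [coeff_mul_mono, coeff_smul, coeff_lineTail, lam, Prod.neg_mk, Prod.mk_add_mk]
  have e : a + -k + l - 1 = a + (l - k) - 1 := by ring
  by_cases hb : b = 1
  · subst hb; simp [e]
  · simp [hb]

/-- A horizontal monomial is split off the right factor and absorbed by the left one, which avoids
computing a product of two infinite series. -/
theorem lineTail_mul_lineTail (l m : ℤ) :
    lineTail l * lineTail m = nu 2 • (lineTail (l - 1) * lineTail (m + 1)) := by
  have h1 : lineTail m = nu 1 • (mono (-(1, 0)) * lineTail (m + 1)) := by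
    rw [mono_mul_lineTail, nu_smul_nu_smul]
    simp
  rw [h1, mul_smul_comm, ← mul_assoc, lineTail_mul_mono, smul_mul_assoc, nu_smul_nu_smul]
  norm_num

theorem coeff_mono_mul_lineTail (k l a b : ℤ) :
    (mono (-(k, -1)) * lineTail l).coeff (a, b) =
      if b = 0 then nu (-a) * tailCoeff (a - k + l - 1) else 0 := by
  simp only [coeff_mono_mul, coeff_lineTail, lam, Prod.neg_mk, Prod.mk_add_mk, neg_neg]
  by_cases hb : b = 0
  · subst hb
    simp only [zero_add, if_true]
    congr 2
    ring
  · rw [if_neg (by omega), if_neg hb, mul_zero]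

theorem coeff_lineTail_mul_mono (k l a b : ℤ) :
    (lineTail l * mono (-(k, -1))).coeff (a, b) =
      if b = 0 then nu a * tailCoeff (a - k + l - 1) else 0 := by
  simp only [coeff_mul_mono, coeff_lineTail, lam, Prod.neg_mk, Prod.mk_add_mk, neg_neg]
  by_cases hb : b = 0
  · subst hb
    simp only [zero_add, if_true]
    congr 2
    ring
  · rw [if_neg (by omega), if_neg hb, mul_zero]

theorem mono_mul_mono_line (k k' : ℤ) :
    mono (-(k, -1)) * mono (-(k', -1)) = nu (k - k') • mono (-(k + k', -2)) := by
  rw [mono_mul_mono]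
  congr 2
  · simp only [lam, Prod.fst_neg, Prod.snd_neg]
    ring
  · simp only [Prod.neg_mk, Prod.mk_add_mk, Prod.mk.injEq]
    constructor <;> ring

theorem bar_lineTail (l : ℤ) : bar (lineTail l) = lineTail l := by
  ext1 ⟨a, b⟩
  rw [coeff_bar, coeff_lineTail]
  split_ifs
  · exact invert_tailCoeff _
  · exact map_zero _

theorem bar_XO (l : ℤ) : bar (XO l) = XO l := by
  rw [XO, bar_add, bar_mono, bar_lineTail]

/-! ### Exchange relations and quasi-commutation -/

theorem nu_mul_nu (m n : ℤ) : nu m * nu n = nu (m + n) := (LaurentPolynomial.T_add m n).symm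

theorem XO_add_two_mul_XO (l : ℤ) :
    XO (l + 2) * XO l = nu 2 • XO (l + 1) ^ 2 + 1 := by
  have h2 : lineTail (l + 2) * lineTail l = nu 2 • (lineTail (l + 1) * lineTail (l + 1)) := by
    rw [lineTail_mul_lineTail, show l + 2 - 1 = l + 1 by ring]
  -- The mixed products fill row `0`, the only row that sees the constant term.
  have h0 : mono (-(l + 2 + 1, -1)) * lineTail l + lineTail (l + 2) * mono (-(l + 1, -1)) =
      nu 2 • (mono (-(l + 1 + 1, -1)) * lineTail (l + 1) +
        lineTail (l + 1) * mono (-(l + 1 + 1, -1))) + 1 := by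
    ext1 ⟨a, b⟩
    simp only [coeff_add, coeff_smul, coeff_mono_mul_lineTail, coeff_lineTail_mul_mono,
      one_def, coeff_mono, neg_zero, Prod.mk_eq_zero]
    by_cases hb : b = 0
    · simp only [hb, if_true, and_true]
      rw [← evenInd_sub a, show a - (l + 2 + 1) + l - 1 = a - 2 - 2 by ring,
        show a - (l + 1) + (l + 2) - 1 = a by ring,
        show a - (l + 1 + 1) + (l + 1) - 1 = a - 2 by ring, tailCoeff_rec a]
      have h := tailCoeff_rec' (a - 2)
      have e1 : nu (-a) * nu a = 1 := by rw [nu_mul_nu]; simp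
      have e2 : nu 2 * nu (-2) = 1 := by rw [nu_mul_nu]; simp
      have e3 : nu 2 * nu (a - 2) = nu a := by rw [nu_mul_nu]; congr 1; ring
      linear_combination (-(nu 2 * nu (-a))) * h + (evenInd a - evenInd (a - 2)) * e1
        - nu (-a) * tailCoeff (a - 2 - 2) * e2 - nu (-a) * evenInd (a - 2) * e3
    · simp [hb]
  have h1 : mono (-(l + 2 + 1, -1)) * mono (-(l + 1, -1)) =
      nu 2 • (mono (-(l + 1 + 1, -1)) * mono (-(l + 1 + 1, -1))) := by
    rw [mono_mul_mono_line, mono_mul_mono_line, nu_smul_nu_smul]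
    congr 2
    · ring
    · ring_nf
  simp only [XO, pow_two, mul_add, add_mul, smul_add, h1, h2] at h0 ⊢
  rw [← sub_eq_zero] at h0 ⊢
  rw [← h0]
  abel

theorem XO_mul_XO_add_two (l : ℤ) :
    XO l * XO (l + 2) = nu (-2) • XO (l + 1) ^ 2 + 1 := by
  simpa [bar_mul, bar_add, bar_nu_smul, bar_XO, bar_pow (bar_XO _), bar_one] using
    congrArg bar (XO_add_two_mul_XO l)

theorem XO_succ_mul_XO (l : ℤ) :
    XO (l + 1) * XO l = nu 2 • (XO l * XO (l + 1)) := by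
  have h2 : lineTail (l + 1) * lineTail l = nu 2 • (lineTail l * lineTail (l + 1)) := by
    rw [lineTail_mul_lineTail, add_sub_cancel_right]
  have h0 : mono (-(l + 1 + 1, -1)) * lineTail l + lineTail (l + 1) * mono (-(l + 1, -1)) =
      nu 2 • (mono (-(l + 1, -1)) * lineTail (l + 1) +
        lineTail l * mono (-(l + 1 + 1, -1))) := by
    ext1 ⟨a, b⟩
    simp only [coeff_add, coeff_smul, coeff_mono_mul_lineTail, coeff_lineTail_mul_mono]
    by_cases hb : b = 0
    · simp only [hb, if_true]
      rw [show a - (l + 1 + 1) + l - 1 = a - 1 - 2 by ring,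
        show a - (l + 1) + (l + 1) - 1 = a - 1 by ring]
      have h := tailCoeff_rec (a - 1)
      have h' := tailCoeff_rec' (a - 1)
      have e1 : nu a * nu (-(a - 1)) = nu 1 := by rw [nu_mul_nu]; congr 1; ring
      have e2 : nu 2 * nu (-2) = 1 := by rw [nu_mul_nu]; simp
      have e3 : nu 2 * nu (-a) * nu (a - 1) = nu 1 := by
        rw [nu_mul_nu, nu_mul_nu]; congr 1; ring
      linear_combination nu a * h - nu 2 * nu (-a) * h' + evenInd (a - 1) * e1
        - nu (-a) * tailCoeff (a - 1 - 2) * e2 - evenInd (a - 1) * e3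
    · simp [hb]
  have h1 : mono (-(l + 1 + 1, -1)) * mono (-(l + 1, -1)) =
      nu 2 • (mono (-(l + 1, -1)) * mono (-(l + 1 + 1, -1))) := by
    rw [mono_mul_mono_line, mono_mul_mono_line, nu_smul_nu_smul]
    congr 2
    · ring
    · ring_nf
  simp only [XO, mul_add, add_mul, smul_add, h1, h2] at h0 ⊢
  rw [← sub_eq_zero] at h0 ⊢
  rw [← h0]
  abel

theorem hasLeadingUnit_XO (l : ℤ) : HasLeadingUnit (XO l) (l + 1, -1) := by
  refine (HasLeadingUnit.mono_neg _).add ?_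
  rintro ⟨a, b⟩ hα
  rw [coeff_lineTail] at hα
  have hb : b = 1 := by by_contra h; exact hα (if_neg h)
  subst hb
  rw [rank_lt_iff]
  left
  norm_num

/-! ### The element `X_δ` -/

theorem Xdelta_one : Xdelta 1 = mono (-(1, 0)) + mono (-(-1, 0)) := by
  rw [Xdelta, if_neg one_ne_zero, Nat.cast_one]

theorem bar_Xdelta (r : ℕ) : bar (Xdelta r) = Xdelta r := by
  rw [Xdelta]
  split_ifs
  · exact bar_one
  · rw [bar_add, bar_mono, bar_mono]

theorem Xdelta_one_mul_XO (l : ℤ) :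
    Xdelta 1 * XO l = nu 1 • XO (l + 1) + nu (-1) • XO (l - 1) := by
  have h1 : mono (-(1, 0)) * mono (-(l + 1, -1)) = nu 1 • mono (-(l + 1 + 1, -1)) := by
    rw [mono_mul_mono]
    congr 2
    · simp [lam]
    · simp
  have h2 : mono (-(-1, 0)) * mono (-(l + 1, -1)) = nu (-1) • mono (-(l - 1 + 1, -1)) := by
    rw [mono_mul_mono]
    congr 2
    · simp [lam]
    · simp
  simp only [Xdelta_one, XO, mul_add, add_mul, smul_add, h1, h2, mono_mul_lineTail, neg_neg,
    sub_neg_eq_add]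
  abel

theorem XO_mul_Xdelta_one (l : ℤ) :
    XO l * Xdelta 1 = nu (-1) • XO (l + 1) + nu 1 • XO (l - 1) := by
  simpa [bar_mul, bar_add, bar_nu_smul, bar_XO, bar_Xdelta] using
    congrArg bar (Xdelta_one_mul_XO l)

theorem XO_add_one_eq (l : ℤ) :
    XO (l + 1) = nu 1 • (XO l * Xdelta 1) - nu 2 • XO (l - 1) := by
  rw [XO_mul_Xdelta_one, smul_add, nu_smul_nu_smul, nu_smul_nu_smul]
  norm_num

theorem XO_sub_one_eq (l : ℤ) :
    XO (l - 1) = nu (-1) • (XO l * Xdelta 1) - nu (-2) • XO (l + 1) := by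
  rw [XO_mul_Xdelta_one, smul_add, nu_smul_nu_smul, nu_smul_nu_smul]
  norm_num

/-- This places `X_δ` in the cluster algebra. After substituting for `XO (l - 1)`, the constant `1`
of the exchange relation, multiplied by `X_δ`, is what survives. -/
theorem Xdelta_one_eq (l : ℤ) :
    Xdelta 1 = nu 1 • (XO (l + 2) * XO (l - 1)) - nu 3 • (XO (l + 1) * XO l) := by
  have h := XO_succ_mul_XO (l + 1)
  have h1 := XO_mul_Xdelta_one (l + 1)
  rw [add_assoc, one_add_one_eq_two] at h h1
  rw [add_sub_cancel_right] at h1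
  rw [XO_sub_one_eq l, mul_sub, mul_smul_comm, mul_smul_comm, ← mul_assoc, XO_add_two_mul_XO, h,
    add_mul, one_mul, smul_mul_assoc, pow_two, mul_assoc, h1]
  simp only [mul_add, smul_add, smul_sub, mul_smul_comm, nu_smul_nu_smul]
  norm_num
  abel

theorem XO_mem (l : ℤ) : XO l ∈ clusterAlgebra := Algebra.subset_adjoin ⟨l, rfl⟩

theorem Xdelta_one_mem : Xdelta 1 ∈ clusterAlgebra := by
  rw [Xdelta_one_eq 0]
  exact sub_mem (Subalgebra.smul_mem _ (mul_mem (XO_mem _) (XO_mem _)) _)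
    (Subalgebra.smul_mem _ (mul_mem (XO_mem _) (XO_mem _)) _)

/-! ### The spanning property -/

theorem span_mul_mem {R A : Type*} [CommSemiring R] [Semiring A] [Algebra R A] {S : Set A}
    {M : Submodule R A} {x : A} (h : ∀ s ∈ S, s * x ∈ M) :
    ∀ m ∈ Submodule.span R S, m * x ∈ M := by
  have : Submodule.span R S ≤ M.comap (LinearMap.mulRight R x) := Submodule.span_le.2 h
  exact fun m hm => this hm

theorem pow_mul_pow_of_nu_commute {x y : Torus} {q : ℤ} (h : y * x = nu q • (x * y)) (a b : ℕ) :
    y ^ b * x ^ a = nu (q * (a * b)) • (x ^ a * y ^ b) := by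
  have h1 (b : ℕ) : y ^ b * x = nu (q * b) • (x * y ^ b) := by
    induction b with
    | zero => simp
    | succ b ih =>
      rw [pow_succ, mul_assoc, h, mul_smul_comm, ← mul_assoc, ih, smul_mul_assoc,
        nu_smul_nu_smul, mul_assoc]
      congr 2
      push_cast
      ring
  induction a with
  | zero => simp
  | succ a ih =>
    rw [pow_succ, ← mul_assoc, ih, smul_mul_assoc, mul_assoc, h1, mul_smul_comm, ← mul_assoc (x ^ a),
      nu_smul_nu_smul]
    congr 2
    push_cast
    ring

/-- The span of the powers of `X_δ` and of the normally ordered monomials in two consecutive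
characters of line bundles. -/
def normalSpan : Submodule Coef Torus := Submodule.span Coef (torBasis₂ ∪ vetBasis)

theorem Xdelta_pow_mem_normalSpan (r : ℕ) : Xdelta 1 ^ r ∈ normalSpan :=
  Submodule.subset_span (Or.inl ⟨r, rfl⟩)

theorem monomial_mem_normalSpan (l : ℤ) (a b : ℕ) :
    XO l ^ a * XO (l + 1) ^ b ∈ normalSpan := by
  have key (l : ℤ) (a b : ℕ) (ha : 1 ≤ a) : XO l ^ a * XO (l + 1) ^ b ∈ normalSpan := by
    have h : nu ((a : ℤ) * b) • (XO l ^ a * XO (l + 1) ^ b) ∈ normalSpan :=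
      Submodule.subset_span (Or.inr ⟨l, a + b, a, ha, Nat.le_add_right a b,
        by rw [Nat.add_sub_cancel_left]⟩)
    have h' := normalSpan.smul_mem (nu (-((a : ℤ) * b))) h
    rwa [nu_smul_nu_smul, neg_add_cancel, nu_zero_smul] at h'
  -- `vetBasis` requires `d ≥ 1`: a pure power of `XO (l + 1)` is indexed from `l + 1`, and the
  -- empty monomial is `X_δ ^ 0`.
  rcases Nat.eq_zero_or_pos a with rfl | ha
  · rcases Nat.eq_zero_or_pos b with rfl | hb
    · simpa using Xdelta_pow_mem_normalSpan 0
    · simpa using key (l + 1) b 0 hb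
  · exact key l a b ha

theorem XO_mem_normalSpan (l : ℤ) : XO l ∈ normalSpan := by
  simpa using monomial_mem_normalSpan l 1 0

theorem monomial_mul_XO_mem (l : ℤ) (a b : ℕ) :
    XO l ^ a * XO (l + 1) ^ b * XO l ∈ normalSpan := by
  have h := pow_mul_pow_of_nu_commute (XO_succ_mul_XO l) 1 b
  rw [pow_one] at h
  rw [mul_assoc, h, mul_smul_comm, ← mul_assoc (XO l ^ a), ← pow_succ]
  exact Submodule.smul_mem _ _ (monomial_mem_normalSpan l _ _)

theorem monomial_mul_XO_add_one_mem (l : ℤ) (a b : ℕ) :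
    XO l ^ a * XO (l + 1) ^ b * XO (l + 1) ∈ normalSpan := by
  rw [mul_assoc, ← pow_succ]
  exact monomial_mem_normalSpan l _ _

/-- The new factor quasi-commutes past `XO (l + 1) ^ b` and meets `XO l`, where the exchange
relation removes it. -/
theorem monomial_mul_XO_add_two_mem (l : ℤ) (a b : ℕ) :
    XO l ^ a * XO (l + 1) ^ b * XO (l + 2) ∈ normalSpan := by
  have e : l + 1 + 1 = l + 2 := by ring
  cases a with
  | zero => simpa [e] using monomial_mem_normalSpan (l + 1) b 1
  | succ a =>
    have h := pow_mul_pow_of_nu_commute (XO_succ_mul_XO (l + 1)) b 1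
    rw [pow_one, e] at h
    have h' : XO (l + 1) ^ b * XO (l + 2) =
        nu (-(2 * (b * (1 : ℕ)))) • (XO (l + 2) * XO (l + 1) ^ b) := by
      rw [h, nu_smul_nu_smul, neg_add_cancel, nu_zero_smul]
    rw [mul_assoc, h', mul_smul_comm, ← mul_assoc (XO l ^ (a + 1)), pow_succ, mul_assoc (XO l ^ a),
      XO_mul_XO_add_two, mul_add, add_mul, mul_smul_comm, smul_mul_assoc, mul_one,
      mul_assoc, ← pow_add]
    exact Submodule.smul_mem _ _ (add_mem (Submodule.smul_mem _ _ (monomial_mem_normalSpan l _ _))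
      (monomial_mem_normalSpan l _ _))

theorem pow_mul_XO_sub_one_mem (l : ℤ) (a : ℕ) : XO l ^ a * XO (l - 1) ∈ normalSpan := by
  have h := pow_mul_pow_of_nu_commute (XO_succ_mul_XO (l - 1)) 1 a
  rw [pow_one, sub_add_cancel] at h
  rw [h]
  refine Submodule.smul_mem _ _ ?_
  simpa using monomial_mem_normalSpan (l - 1) 1 a

/-- `X_δ` replaces the last factor by its two neighbours. If `b = 0` one neighbour is `XO (l - 1)`,
and the monomial is reordered in the pair `l - 1, l`. -/
theorem monomial_mul_Xdelta_mem (l : ℤ) (a b : ℕ) :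
    XO l ^ a * XO (l + 1) ^ b * Xdelta 1 ∈ normalSpan := by
  cases b with
  | succ b =>
    rw [pow_succ, ← mul_assoc, mul_assoc, XO_mul_Xdelta_one, mul_add, mul_smul_comm,
      mul_smul_comm, add_assoc, one_add_one_eq_two, add_sub_cancel_right]
    exact add_mem (Submodule.smul_mem _ _ (monomial_mul_XO_add_two_mem l a b))
      (Submodule.smul_mem _ _ (monomial_mul_XO_mem l a b))
  | zero =>
    rw [pow_zero, mul_one]
    cases a with
    | zero => simpa using Xdelta_pow_mem_normalSpan 1
    | succ a =>
      rw [pow_succ, mul_assoc, XO_mul_Xdelta_one, mul_add, mul_smul_comm, mul_smul_comm]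
      refine add_mem (Submodule.smul_mem _ _ ?_)
        (Submodule.smul_mem _ _ (pow_mul_XO_sub_one_mem l a))
      simpa using monomial_mem_normalSpan l a 1

theorem normalSpan_mul_Xdelta_mem : ∀ f ∈ normalSpan, f * Xdelta 1 ∈ normalSpan := by
  refine span_mul_mem ?_
  rintro f (⟨r, rfl⟩ | ⟨l, r, d, -, -, rfl⟩)
  · simpa only [← pow_succ] using Xdelta_pow_mem_normalSpan (r + 1)
  · rw [smul_mul_assoc]
    exact Submodule.smul_mem _ _ (monomial_mul_Xdelta_mem l _ _)

/-- The products of `f` with all line bundle characters are determined by those with two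
consecutive ones, as long as we may multiply by `X_δ`. -/
theorem mul_XO_mem_of_consecutive {f : Torus} {l : ℤ} (h0 : f * XO l ∈ normalSpan)
    (h1 : f * XO (l + 1) ∈ normalSpan) (m : ℤ) : f * XO m ∈ normalSpan := by
  suffices h : ∀ k : ℤ, f * XO (l + k) ∈ normalSpan ∧ f * XO (l + k + 1) ∈ normalSpan by
    simpa using (h (m - l)).1
  intro k
  induction k with
  | zero => simpa using ⟨h0, h1⟩
  | succ k ih =>
    rw [← add_assoc]
    refine ⟨ih.2, ?_⟩
    rw [XO_add_one_eq, add_sub_cancel_right, mul_sub, mul_smul_comm, mul_smul_comm, ← mul_assoc]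
    exact sub_mem (Submodule.smul_mem _ _ (normalSpan_mul_Xdelta_mem _ ih.2))
      (Submodule.smul_mem _ _ ih.1)
  | pred k ih =>
    rw [← add_sub_assoc, sub_add_cancel]
    refine ⟨?_, ih.1⟩
    rw [XO_sub_one_eq, mul_sub, mul_smul_comm, mul_smul_comm, ← mul_assoc]
    exact sub_mem (Submodule.smul_mem _ _ (normalSpan_mul_Xdelta_mem _ ih.1))
      (Submodule.smul_mem _ _ ih.2)

theorem Xdelta_pow_mul_XO_mem (r : ℕ) (l : ℤ) : Xdelta 1 ^ r * XO l ∈ normalSpan := by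
  induction r generalizing l with
  | zero => simpa using XO_mem_normalSpan l
  | succ r ih =>
    rw [pow_succ, mul_assoc, Xdelta_one_mul_XO, mul_add, mul_smul_comm, mul_smul_comm]
    exact add_mem (Submodule.smul_mem _ _ (ih _)) (Submodule.smul_mem _ _ (ih _))

theorem normalSpan_mul_XO_mem (m : ℤ) : ∀ f ∈ normalSpan, f * XO m ∈ normalSpan := by
  refine span_mul_mem ?_
  rintro f (⟨r, rfl⟩ | ⟨l, r, d, -, -, rfl⟩)
  · exact Xdelta_pow_mul_XO_mem r m
  · rw [smul_mul_assoc]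
    exact Submodule.smul_mem _ _ (mul_XO_mem_of_consecutive (monomial_mul_XO_mem l _ _)
      (monomial_mul_XO_add_one_mem l _ _) m)

theorem normalSpan_eq : normalSpan = Subalgebra.toSubmodule clusterAlgebra := by
  apply le_antisymm
  · refine Submodule.span_le.2 ?_
    rintro f (⟨r, rfl⟩ | ⟨l, r, d, -, -, rfl⟩)
    · exact pow_mem Xdelta_one_mem r
    · exact Subalgebra.smul_mem _ (mul_mem (pow_mem (XO_mem _) _) (pow_mem (XO_mem _) _)) _
  · intro f hf
    -- Right stability passes to products of multipliers, unlike bare membership; it is then applied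
    -- to `m = 1`.
    have h : ∀ m ∈ normalSpan, m * f ∈ normalSpan := by
      refine Algebra.adjoin_induction (p := fun f _ => ∀ m ∈ normalSpan, m * f ∈ normalSpan)
        ?_ ?_ ?_ ?_ (show f ∈ clusterAlgebra from hf)
      · rintro _ ⟨l, rfl⟩
        exact normalSpan_mul_XO_mem l
      · intro r m hm
        rw [← Algebra.commutes, ← Algebra.smul_def]
        exact Submodule.smul_mem _ _ hm
      · intro x y _ _ hx hy m hm
        rw [mul_add]
        exact add_mem (hx m hm) (hy m hm)
      · intro x y _ _ hx hy m hm
        rw [← mul_assoc]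
        exact hy _ (hx m hm)
    simpa using h 1 (by simpa using Xdelta_pow_mem_normalSpan 0)

/-! ### Bases of the torsion part -/

/-- A sequence of Chebyshev type in `z`: a three-term recurrence with initial values `1` and `z`. -/
structure IsChebyshevSeq {A : Type*} [Ring A] [Algebra Coef A] (z : A) (p : ℕ → A) : Prop where
  zero : p 0 = 1
  one : p 1 = z
  recurrence : ∀ n, ∃ c : Coef, p (n + 2) = p (n + 1) * z - c • p n

namespace IsChebyshevSeq

/-- Both spans contain `1` and are stable under right multiplication by `z`; the recurrence turns
this into the two inclusions. -/
theorem span_eq {A : Type*} [Ring A] [Algebra Coef A] {z : A} {p : ℕ → A}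
    (hp : IsChebyshevSeq z p) :
    Submodule.span Coef (Set.range p) = Submodule.span Coef (Set.range fun n : ℕ => z ^ n) := by
  apply le_antisymm <;> rw [Submodule.span_le] <;> rintro _ ⟨n, rfl⟩
  · have hz : ∀ m ∈ Submodule.span Coef (Set.range fun n : ℕ => z ^ n),
        m * z ∈ Submodule.span Coef (Set.range fun n : ℕ => z ^ n) := by
      refine span_mul_mem ?_
      rintro _ ⟨n, rfl⟩
      exact Submodule.subset_span ⟨n + 1, pow_succ z n⟩
    induction n using Nat.twoStepInduction with
    | zero => exact Submodule.subset_span ⟨0, by simp [hp.zero]⟩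
    | one => exact Submodule.subset_span ⟨1, by simp [hp.one]⟩
    | more n h0 h1 =>
      obtain ⟨c, hc⟩ := hp.recurrence n
      rw [hc]
      exact sub_mem (hz _ h1) (Submodule.smul_mem _ _ h0)
  · have hz : ∀ m ∈ Submodule.span Coef (Set.range p),
        m * z ∈ Submodule.span Coef (Set.range p) := by
      refine span_mul_mem ?_
      rintro _ ⟨n, rfl⟩
      cases n with
      | zero => exact Submodule.subset_span ⟨1, by rw [hp.zero, hp.one, one_mul]⟩
      | succ n =>
        obtain ⟨c, hc⟩ := hp.recurrence n
        rw [eq_add_of_sub_eq hc.symm]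
        exact add_mem (Submodule.subset_span ⟨_, rfl⟩)
          (Submodule.smul_mem _ _ (Submodule.subset_span ⟨_, rfl⟩))
    induction n with
    | zero => exact Submodule.subset_span ⟨0, by simp [hp.zero]⟩
    | succ n ih =>
      have h := hz _ ih
      rwa [← pow_succ] at h

theorem hasLeadingUnit {p : ℕ → Torus} (hp : IsChebyshevSeq (Xdelta 1) p) (n : ℕ) :
    HasLeadingUnit (p n) (-(n : ℤ), 0) := by
  have hz : HasLeadingUnit (Xdelta 1) (-1, 0) := by
    rw [Xdelta_one, add_comm]
    refine (HasLeadingUnit.mono_neg _).add fun α hα => ?_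
    rw [coeff_mono, neg_neg] at hα
    have : α = (1, 0) := by by_contra h; exact hα (if_neg h)
    rw [this, rank_lt_iff]
    norm_num
  induction n using Nat.twoStepInduction with
  | zero => rw [hp.zero]; exact HasLeadingUnit.one
  | one => rw [hp.one]; exact hz
  | more n h0 h1 =>
    obtain ⟨c, hc⟩ := hp.recurrence n
    rw [hc, sub_eq_add_neg, ← neg_smul]
    have h := h1.mul hz
    have e : ((-((n + 1 : ℕ) : ℤ), 0) + (-1, 0) : ℤ × ℤ) = (-((n + 2 : ℕ) : ℤ), 0) := by
      ext
      · push_cast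
        simp
        ring
      · rfl
    rw [e] at h
    -- The correction `c • p n` starts at `-n`, strictly above `-(n + 2)`, so the value of `c` is
    -- irrelevant.
    refine h.add fun α hα => lt_of_lt_of_le ?_ (h0.le α (right_ne_zero_of_mul hα))
    rw [rank_lt_iff]
    right
    constructor
    · rfl
    · push_cast
      linarith

end IsChebyshevSeq

theorem isChebyshevSeq_pow : IsChebyshevSeq (Xdelta 1) fun r : ℕ => Xdelta 1 ^ r where
  zero := pow_zero _
  one := pow_one _
  recurrence n := ⟨0, by rw [zero_smul, sub_zero, ← pow_succ]⟩

theorem mono_mul_Xdelta_one (a : ℤ) :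
    mono (-(a, 0)) * Xdelta 1 = mono (-(a + 1, 0)) + mono (-(a - 1, 0)) := by
  rw [Xdelta_one, mul_add, mono_mul_mono, mono_mul_mono, ← neg_add, ← neg_add]
  simp only [lam, Prod.mk_add_mk, Prod.fst_neg, Prod.snd_neg, add_zero, ← sub_eq_add_neg]
  simp

theorem isChebyshevSeq_Xdelta : IsChebyshevSeq (Xdelta 1) Xdelta where
  zero := if_pos rfl
  one := rfl
  recurrence n := by
    have h : Xdelta (n + 1) * Xdelta 1 =
        Xdelta (n + 2) + (mono (-((n : ℤ), 0)) + mono (-(-(n : ℤ), 0))) := by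
      have hX (m : ℕ) (hm : m ≠ 0) : Xdelta m = mono (-((m : ℤ), 0)) + mono (-(-(m : ℤ), 0)) :=
        if_neg hm
      rw [hX _ (Nat.succ_ne_zero n), hX (n + 2) (by omega), add_mul,
        mono_mul_Xdelta_one, mono_mul_Xdelta_one]
      have e1 : ((n + 1 : ℕ) : ℤ) + 1 = (n + 2 : ℕ) := by push_cast; ring
      have e2 : ((n + 1 : ℕ) : ℤ) - 1 = n := by push_cast; ring
      have e3 : -((n + 1 : ℕ) : ℤ) + 1 = -n := by push_cast; ring
      have e4 : -((n + 1 : ℕ) : ℤ) - 1 = -(n + 2 : ℕ) := by push_cast; ring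
      rw [e1, e2, e3, e4]
      abel
    cases n with
    | zero =>
      -- The formula for `r ≥ 1` would give `2` at `r = 0`, whereas `Xdelta 0 = 1`; hence `c = 2`
      -- here and `1` afterwards.
      refine ⟨2, ?_⟩
      rw [h, eq_comm, sub_eq_iff_eq_add, add_right_inj, Xdelta, if_pos rfl, two_smul]
      rfl
    | succ n =>
      refine ⟨1, ?_⟩
      rw [h, Xdelta, Xdelta, if_neg (Nat.succ_ne_zero n), one_smul, add_sub_cancel_right]

theorem isChebyshevSeq_XE : IsChebyshevSeq (Xdelta 1) XE where
  zero := by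
    rw [XE, zero_add, Finset.sum_range_one]
    rfl
  one := by simp [XE, Xdelta_one, Finset.sum_range_succ]
  recurrence n := by
    refine ⟨1, ?_⟩
    rw [one_smul, eq_sub_iff_add_eq]
    have h1 : XE (n + 1) * Xdelta 1 =
        (∑ l ∈ Finset.range (n + 2), mono (-(((n + 2 : ℕ) : ℤ) - 2 * (l : ℤ), 0))) +
          ∑ l ∈ Finset.range (n + 2), mono (-((n : ℤ) - 2 * (l : ℤ), 0)) := by
      rw [XE, Finset.sum_mul, ← Finset.sum_add_distrib]
      refine Finset.sum_congr rfl fun l _ => ?_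
      rw [mono_mul_Xdelta_one]
      have e1 : ((n + 1 : ℕ) : ℤ) - 2 * l + 1 = (n + 2 : ℕ) - 2 * l := by push_cast; ring
      have e2 : ((n + 1 : ℕ) : ℤ) - 2 * l - 1 = n - 2 * l := by push_cast; ring
      rw [e1, e2]
    -- The last term of `XE (n + 2)` is the one by which the second sum exceeds `XE n`.
    have e : ((n + 2 : ℕ) : ℤ) - 2 * (n + 2 : ℕ) = n - 2 * (n + 1 : ℕ) := by push_cast; ring
    rw [h1, XE, XE, Finset.sum_range_succ _ (n + 2), e,
      Finset.sum_range_succ (fun l : ℕ => mono (-((n : ℤ) - 2 * (l : ℤ), 0))) (n + 1)]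
    abel

theorem bar_XE (r : ℕ) : bar (XE r) = XE r := by
  simp only [XE, bar_sum, bar_mono]

/-! ### The bases -/

/-- Bar reverses the monomial; restoring the order costs `ν ^ (2 d (r - d))`, and the normalisation
is half of this exponent. -/
theorem bar_eq_of_mem_vetBasis {f : Torus} (hf : f ∈ vetBasis) : bar f = f := by
  obtain ⟨l, r, d, -, -, rfl⟩ := hf
  rw [bar_nu_smul, bar_mul, bar_pow (bar_XO _), bar_pow (bar_XO _),
    pow_mul_pow_of_nu_commute (XO_succ_mul_XO l), nu_smul_nu_smul]
  congr 2
  ring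

theorem hasLeadingUnit_vet (l n : ℤ) (a b : ℕ) :
    HasLeadingUnit (nu n • (XO l ^ a * XO (l + 1) ^ b))
      (((a + b : ℕ) : ℤ) * (l + 1) + b, -((a + b : ℕ) : ℤ)) := by
  have h := (((hasLeadingUnit_XO l).pow a).mul ((hasLeadingUnit_XO (l + 1)).pow b)).nu_smul n
  convert h using 1
  ext
  · simp
    ring
  · simp
    ring

/-- Uniqueness of division by `r`, with quotient `l + 1` and remainder `e`. In the application `e =
r - d`, and `d ≥ 1` gives `e < r`. -/
theorem vet_index_unique {l l' : ℤ} {r r' e e' : ℕ} (he : e < r) (he' : e' < r')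
    (h1 : (r : ℤ) * (l + 1) + e = r' * (l' + 1) + e') (h2 : -(r : ℤ) = -(r' : ℤ)) :
    l = l' ∧ r = r' ∧ e = e' := by
  obtain rfl : r = r' := by omega
  have hl : l = l' := by
    rcases lt_trichotomy l l' with h | h | h
    · nlinarith
    · exact h
    · nlinarith
  subst hl
  exact ⟨rfl, rfl, by omega⟩

theorem isBarInvariantBasis_of_isChebyshevSeq {p : ℕ → Torus}
    (hp : IsChebyshevSeq (Xdelta 1) p) (hbar : ∀ n, bar (p n) = p n) :
    IsBarInvariantBasis (Set.range p ∪ vetBasis) where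
  linearIndepOn := by
    have hvet (l : ℤ) (r d : ℕ) (hdr : d ≤ r) :
        HasLeadingUnit (nu ((d : ℤ) * ((r - d : ℕ) : ℤ)) • (XO l ^ d * XO (l + 1) ^ (r - d)))
          ((r : ℤ) * (l + 1) + (r - d : ℕ), -(r : ℤ)) := by
      have h := hasLeadingUnit_vet l ((d : ℤ) * ((r - d : ℕ) : ℤ)) d (r - d)
      rwa [Nat.add_sub_cancel' hdr] at h
    apply linearIndepOn_of_hasLeadingUnit
    · rintro f (⟨n, rfl⟩ | ⟨l, r, d, -, hdr, rfl⟩)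
      · exact ⟨_, hp.hasLeadingUnit n⟩
      · exact ⟨_, hvet l r d hdr⟩
    · rintro f (⟨n, rfl⟩ | ⟨l, r, d, hd, hdr, rfl⟩) g (⟨n', rfl⟩ | ⟨l', r', d', hd', hdr', rfl⟩)
        k hf hg
      · have h := ((hp.hasLeadingUnit n).eq hf).trans (hg.eq (hp.hasLeadingUnit n'))
        rw [Prod.mk.injEq] at h
        rw [show n = n' by omega]
      -- The second coordinate separates the families: `0` on the torsion side, `-r' < 0` on the
      -- other.
      · have h := ((hp.hasLeadingUnit n).eq hf).trans (hg.eq (hvet l' r' d' hdr'))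
        rw [Prod.mk.injEq] at h
        omega
      · have h := ((hvet l r d hdr).eq hf).trans (hg.eq (hp.hasLeadingUnit n'))
        rw [Prod.mk.injEq] at h
        omega
      · have h := ((hvet l r d hdr).eq hf).trans (hg.eq (hvet l' r' d' hdr'))
        rw [Prod.mk.injEq] at h
        obtain ⟨rfl, rfl, he⟩ := vet_index_unique (by omega) (by omega) h.1 h.2
        rw [show d = d' by omega]
  span_eq := by
    rw [Submodule.span_union, hp.span_eq, ← normalSpan_eq, normalSpan, Submodule.span_union]
    rfl
  bar_eq := by
    rintro f (⟨n, rfl⟩ | hf)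
    · exact hbar n
    · exact bar_eq_of_mem_vetBasis hf

end QuantumP1

end

theorem theorem5p14 :
    (∀ l : ℤ,
      QuantumP1.XO (l + 2) * QuantumP1.XO l = QuantumP1.nu 2 • QuantumP1.XO (l + 1) ^ 2 + 1 ∧
      QuantumP1.XO l * QuantumP1.XO (l + 2) = QuantumP1.nu (-2) • QuantumP1.XO (l + 1) ^ 2 + 1 ∧
      QuantumP1.XO (l + 1) * QuantumP1.XO l =
        QuantumP1.nu 2 • (QuantumP1.XO l * QuantumP1.XO (l + 1))) ∧
    QuantumP1.IsBarInvariantBasis (QuantumP1.torBasis₁ ∪ QuantumP1.vetBasis) ∧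
    QuantumP1.IsBarInvariantBasis (QuantumP1.torBasis₂ ∪ QuantumP1.vetBasis) ∧
    QuantumP1.IsBarInvariantBasis (QuantumP1.torBasis₃ ∪ QuantumP1.vetBasis) :=
  ⟨fun l => ⟨QuantumP1.XO_add_two_mul_XO l, QuantumP1.XO_mul_XO_add_two l,
      QuantumP1.XO_succ_mul_XO l⟩,
    QuantumP1.isBarInvariantBasis_of_isChebyshevSeq QuantumP1.isChebyshevSeq_Xdelta
      QuantumP1.bar_Xdelta,
    QuantumP1.isBarInvariantBasis_of_isChebyshevSeq QuantumP1.isChebyshevSeq_pow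
      fun n => QuantumP1.Torus.bar_pow (QuantumP1.bar_Xdelta 1) n,
    QuantumP1.isBarInvariantBasis_of_isChebyshevSeq QuantumP1.isChebyshevSeq_XE
      QuantumP1.bar_XE⟩
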